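/- Say that a polynomial $P\in\mathbb{R}[x_1,\dots,x_n]$ has a zero of multiplicity at least $m$ at a point $a\in\mathbb{R}^n$ if all partial derivatives of $P$ of order at most $m-1$ (including $P$ itself, as the derivative of order $0$) vanish at $a$ (no condition if $m=0$), and a zero of multiplicity exactly $m$ at $a$ if it has a zero of multiplicity at least $m$ but not at least $m+1$ at $a$. Let $k\ge 2$ and $n\ge 2k-3$ be integers. Let $P\in\mathbb{R}[x_1,\dots,x_n]$ be a polynomial having zeroes of multiplicity at least $k$ at all points of $\{0,1\}^n\setminus\{(0,\dots,0)\}$, and such that $P$ does not have a zero of multiplicity at least $k-1$ at $(0,\dots,0)$. Then $\deg P\ge n+2k-3$. Furthermore, for every $\ell=0,\dots,k-2$ there exists a polynomial $P\in\mathbb{R}[x_1,\dots,x_n]$ of degree exactly $n+2k-3$ having zeroes of multiplicity at least $k$ at all points of $\{0,1\}^n\setminus\{(0,\dots,0)\}$ and a zero of multiplicity exactly $\ell$ at $(0,\dots,0)$. -/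

import Mathlib

/-- `P` has a zero of multiplicity at least `k` at `a`: all partial derivatives
`∂_{i₁} ⋯ ∂_{iₘ} P` of order `m ≤ k - 1` (i.e. `m < k`) vanish at `a`. The order-`0` derivative
is `P` itself; for `k = 0` there is no condition. -/
def HasZeroOfMultAtLeast {n : ℕ} (P : MvPolynomial (Fin n) ℝ) (a : Fin n → ℝ) (k : ℕ) : Prop :=
  ∀ l : List (Fin n), l.length < k →
    MvPolynomial.eval a (l.foldr (fun i Q => MvPolynomial.pderiv i Q) P) = 0

/-- `P` has a zero of multiplicity exactly `k` at `a` (for `k = 0`: `P` does not vanish at `a`). -/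
def HasZeroOfMultExactly {n : ℕ} (P : MvPolynomial (Fin n) ℝ) (a : Fin n → ℝ) (k : ℕ) : Prop :=
  HasZeroOfMultAtLeast P a k ∧ ¬ HasZeroOfMultAtLeast P a (k + 1)

/-- `P` has zeroes of multiplicity at least `k` at all points of `{0,1}ⁿ` other than the origin. -/
def VanishesOnPuncturedCube {n : ℕ} (P : MvPolynomial (Fin n) ℝ) (k : ℕ) : Prop :=
  ∀ a : Fin n → ℝ, (∀ i, a i = 0 ∨ a i = 1) → a ≠ 0 → HasZeroOfMultAtLeast P a k

/-! Both halves use the two roots `x` and `1 - x` of `x (1 - x) = t`, and the power series `c(t) = t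
* Cat(t)` giving the root that vanishes at `t = 0`. Existence: `1 - x - c(x (1 - x))` vanishes to
infinite order at `x = 1` and is `1` at `x = 0`. In the product of these over all variables, terms
of total degree at least `k` in the `xᵢ (1 - xᵢ)` vanish to order `k` on the whole cube, so they may
be dropped (`cubePoly`). Factors `xᵢ (1 - xᵢ)` then raise `k` and `l` together. Lower bound: along
the arc `xᵢ = c(uᵢ s)`, the signed sum of `P` over all flips `xᵢ ↦ 1 - xᵢ` is `∏ (1 - 2 xᵢ) * p(s)`
with `2 deg p ≤ deg P - n`. Every nontrivial flip passes through a nonzero cube point, so `P` on the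
arc is this modulo `s ^ k`. If `deg P ≤ n + 2k - 4`, comparing `P` with `xᵢ P` makes every `uᵢ` a
root of one polynomial of degree at most `k - 2`; since `n ≥ k - 1`, it is zero, and so is `p`.
Taking the `uᵢ` to be indeterminates, `P` vanishes to order `k` at the origin. -/

namespace HasZeroOfMultAtLeast

/-! ### Calculus of multiplicities. -/

variable {n : ℕ} {P Q : MvPolynomial (Fin n) ℝ} {a : Fin n → ℝ} {j k : ℕ}

theorem zero_order : HasZeroOfMultAtLeast P a 0 := fun _ hl => absurd hl (Nat.not_lt_zero _)

theorem succ_iff : HasZeroOfMultAtLeast P a (k + 1) ↔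
    MvPolynomial.eval a P = 0 ∧ ∀ i, HasZeroOfMultAtLeast (MvPolynomial.pderiv i P) a k := by
  constructor
  · intro h
    refine ⟨h [] (by simp), fun i l hl => ?_⟩
    -- `foldr` applies the last entry of the list first.
    have := h (l ++ [i]) (by simpa using hl)
    simpa using this
  · rintro ⟨h0, h1⟩ l hl
    rcases List.eq_nil_or_concat l with rfl | ⟨l, i, rfl⟩
    · simpa using h0
    · have := h1 i l (by simpa using hl)
      simpa using this

theorem mono (h : HasZeroOfMultAtLeast P a k) (hjk : j ≤ k) : HasZeroOfMultAtLeast P a j :=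
  fun l hl => h l (hl.trans_le hjk)

theorem zero_poly : HasZeroOfMultAtLeast (0 : MvPolynomial (Fin n) ℝ) a k := by
  induction k with
  | zero => exact zero_order
  | succ k ih => exact succ_iff.2 ⟨by simp, fun i => by simpa using ih⟩

theorem add (hP : HasZeroOfMultAtLeast P a k) (hQ : HasZeroOfMultAtLeast Q a k) :
    HasZeroOfMultAtLeast (P + Q) a k := by
  induction k generalizing P Q with
  | zero => exact zero_order
  | succ k ih =>
    rw [succ_iff] at hP hQ ⊢
    refine ⟨by simp [hP.1, hQ.1], fun i => ?_⟩
    rw [map_add]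
    exact ih (hP.2 i) (hQ.2 i)

theorem mul (hP : HasZeroOfMultAtLeast P a j) (hQ : HasZeroOfMultAtLeast Q a k) :
    HasZeroOfMultAtLeast (P * Q) a (j + k) := by
  induction hm : j + k generalizing P Q j k with
  | zero => exact zero_order
  | succ m ih =>
    rw [succ_iff]
    constructor
    · rw [map_mul, mul_eq_zero]
      rcases j with _ | j
      · exact Or.inr (succ_iff.1 (hQ.mono (show m + 1 ≤ k by omega))).1
      · exact Or.inl (succ_iff.1 hP).1
    · intro i
      rw [Derivation.leibniz, smul_eq_mul, smul_eq_mul]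
      apply add
      -- For `k = 0` nothing is known of the derivative of `Q`, but then `j = m + 1` and `P` alone
      -- has enough order.
      · rcases k with _ | k
        · exact ih (j := m) (k := 0) (hP.mono (by omega)) zero_order (by omega)
        · exact ih hP ((succ_iff.1 hQ).2 i) (by omega)
      · rcases j with _ | j
        · exact ih (j := m) (k := 0) (hQ.mono (by omega)) zero_order (by omega)
        · exact ih hQ ((succ_iff.1 hP).2 i) (by omega)

theorem mul_left (Q : MvPolynomial (Fin n) ℝ) (hP : HasZeroOfMultAtLeast P a k) :
    HasZeroOfMultAtLeast (Q * P) a k := by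
  simpa using (zero_order (P := Q) (a := a)).mul hP

theorem of_dvd (hP : HasZeroOfMultAtLeast P a k) (h : P ∣ Q) : HasZeroOfMultAtLeast Q a k := by
  obtain ⟨R, rfl⟩ := h
  rw [mul_comm]
  exact hP.mul_left R

theorem pow (hP : HasZeroOfMultAtLeast P a 1) (k : ℕ) : HasZeroOfMultAtLeast (P ^ k) a k := by
  induction k with
  | zero => exact zero_order
  | succ k ih => rw [pow_succ]; exact ih.mul hP

theorem one_iff : HasZeroOfMultAtLeast P a 1 ↔ MvPolynomial.eval a P = 0 := by
  rw [succ_iff]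
  exact ⟨fun h => h.1, fun h => ⟨h, fun _ => zero_order⟩⟩

theorem sum {ι : Type*} {s : Finset ι} {f : ι → MvPolynomial (Fin n) ℝ}
    (h : ∀ i ∈ s, HasZeroOfMultAtLeast (f i) a k) : HasZeroOfMultAtLeast (∑ i ∈ s, f i) a k :=
  Finset.sum_induction f (HasZeroOfMultAtLeast · a k) (fun _ _ => add) zero_poly h

theorem prod {ι : Type*} {s : Finset ι} {f : ι → MvPolynomial (Fin n) ℝ} {e : ι → ℕ}
    (h : ∀ i ∈ s, HasZeroOfMultAtLeast (f i) a (e i)) :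
    HasZeroOfMultAtLeast (∏ i ∈ s, f i) a (∑ i ∈ s, e i) := by
  classical
  induction s using Finset.induction_on with
  | empty => exact zero_order
  | insert i s his ih =>
    rw [Finset.prod_insert his, Finset.sum_insert his]
    exact (h i (Finset.mem_insert_self i s)).mul
      (ih fun j hj => h j (Finset.mem_insert_of_mem hj))

theorem neg (hP : HasZeroOfMultAtLeast P a k) : HasZeroOfMultAtLeast (-P) a k :=
  hP.of_dvd (by simp)

/-- By induction on `k`: `Q(a) P = P Q - P (Q - Q(a))`, and the last product gains one order from
its second factor. -/
theorem of_mul_right (h : HasZeroOfMultAtLeast (P * Q) a k) (hQ : MvPolynomial.eval a Q ≠ 0) :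
    HasZeroOfMultAtLeast P a k := by
  induction k with
  | zero => exact zero_order
  | succ k ih =>
    have h1 : HasZeroOfMultAtLeast (Q - MvPolynomial.C (MvPolynomial.eval a Q)) a 1 := by
      rw [one_iff]
      simp
    have h2 := (h.add ((ih (h.mono k.le_succ)).mul h1).neg).mul_left
      (MvPolynomial.C (MvPolynomial.eval a Q)⁻¹)
    convert h2 using 1
    have hC : MvPolynomial.C (MvPolynomial.eval a Q)⁻¹ * MvPolynomial.C (MvPolynomial.eval a Q) =
        (1 : MvPolynomial (Fin n) ℝ) := by
      rw [← MvPolynomial.C_mul, inv_mul_cancel₀ hQ, MvPolynomial.C_1]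
    linear_combination -P * hC

theorem at_zero_iff :
    HasZeroOfMultAtLeast P 0 k ↔ ∀ d : Fin n →₀ ℕ, d.degree < k → P.coeff d = 0 := by
  induction k generalizing P with
  | zero => exact ⟨fun _ _ h => absurd h (Nat.not_lt_zero _), fun _ => zero_order⟩
  | succ k ih =>
    rw [succ_iff]
    simp only [ih, MvPolynomial.coeff_pderiv]
    constructor
    · rintro ⟨h0, h1⟩ d hd
      by_cases hd0 : d = 0
      · subst hd0
        simpa [← MvPolynomial.constantCoeff_eq] using h0
      · obtain ⟨i, hi⟩ := Finsupp.ne_iff.1 hd0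
        have hle : Finsupp.single i 1 ≤ d := by
          rw [Finsupp.single_le_iff]
          exact Nat.one_le_iff_ne_zero.2 hi
        have hdd : d - Finsupp.single i 1 + Finsupp.single i 1 = d := tsub_add_cancel_of_le hle
        have hdeg : (d - Finsupp.single i 1).degree + 1 = d.degree := by
          conv_rhs => rw [← hdd]
          simp [Finsupp.degree_single]
        have := h1 i (d - Finsupp.single i 1) (by omega)
        rw [hdd] at this
        refine (mul_eq_zero.1 this).resolve_right ?_
        positivity
    · intro h
      refine ⟨?_, fun i d hd => ?_⟩
      · have := h 0 (by simp)
        simpa [← MvPolynomial.constantCoeff_eq] using this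
      · rw [h _ (by simp [Finsupp.degree_single]; omega), zero_mul]

end HasZeroOfMultAtLeast

/-! ### Order of vanishing along formal arcs. -/

/-- The chain rule for a polynomial evaluated at power series. -/
theorem PowerSeries.derivative_aeval {σ A : Type*} [Fintype σ] [CommRing A] [Algebra ℝ A]
    (y : σ → PowerSeries A) (P : MvPolynomial σ ℝ) :
    PowerSeries.derivative A (MvPolynomial.aeval y P) =
      ∑ i, MvPolynomial.aeval y (MvPolynomial.pderiv i P) * PowerSeries.derivative A (y i) := by
  classical
  induction P using MvPolynomial.induction_on with
  | C r =>
    simp [IsScalarTower.algebraMap_apply ℝ A (PowerSeries A)]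
  | add P Q hP hQ => simp [hP, hQ, add_mul, Finset.sum_add_distrib]
  | mul_X P j hP =>
    simp only [map_mul, Derivation.leibniz, MvPolynomial.aeval_X, smul_eq_mul, hP,
      MvPolynomial.pderiv_X, map_add, add_mul, Finset.sum_add_distrib, Finset.mul_sum]
    congr 1
    · rw [Finset.sum_eq_single j]
      · simp
      · intro i _ hij
        simp [hij.symm]
      · simp
    · exact Finset.sum_congr rfl fun i _ => by ring

theorem PowerSeries.X_pow_succ_dvd_of_derivative {A : Type*} [CommRing A] [Algebra ℝ A]
    {f : PowerSeries A} {k : ℕ} (h0 : PowerSeries.constantCoeff f = 0)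
    (h : PowerSeries.X ^ k ∣ PowerSeries.derivative A f) : PowerSeries.X ^ (k + 1) ∣ f := by
  rw [PowerSeries.X_pow_dvd_iff] at h ⊢
  rintro (_ | m) hm
  · simpa using h0
  · have hc := h m (by omega)
    rw [PowerSeries.coeff_derivative] at hc
    have hu : IsUnit ((m : A) + 1) := by
      have : (m : A) + 1 = algebraMap ℝ A ((m : ℝ) + 1) := by simp
      rw [this]
      exact (IsUnit.mk0 _ (by positivity)).map _
    exact hu.mul_left_eq_zero.1 hc

theorem PowerSeries.constantCoeff_aeval {σ A : Type*} [CommRing A] [Algebra ℝ A]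
    {y : σ → PowerSeries A} {a : σ → ℝ}
    (hy : ∀ i, PowerSeries.constantCoeff (y i) = algebraMap ℝ A (a i)) (P : MvPolynomial σ ℝ) :
    PowerSeries.constantCoeff (MvPolynomial.aeval y P) =
      algebraMap ℝ A (MvPolynomial.eval a P) := by
  induction P using MvPolynomial.induction_on with
  | C r => simp [IsScalarTower.algebraMap_apply ℝ A (PowerSeries A)]
  | add P Q hP hQ => simp only [map_add, hP, hQ]
  | mul_X P j hP => simp only [map_mul, hP, MvPolynomial.aeval_X, MvPolynomial.eval_X, hy]

/-- A polynomial with a zero of multiplicity at least `k` at `a` has order at least `k` along any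
formal arc through `a`. -/
theorem HasZeroOfMultAtLeast.X_pow_dvd_aeval {n k : ℕ} {A : Type*} [CommRing A] [Algebra ℝ A]
    {P : MvPolynomial (Fin n) ℝ} {a : Fin n → ℝ} (hP : HasZeroOfMultAtLeast P a k)
    (y : Fin n → PowerSeries A)
    (hy : ∀ i, PowerSeries.constantCoeff (y i) = algebraMap ℝ A (a i)) :
    PowerSeries.X ^ k ∣ MvPolynomial.aeval y P := by
  induction k generalizing P with
  | zero => simp
  | succ k ih =>
    rw [succ_iff] at hP
    apply PowerSeries.X_pow_succ_dvd_of_derivative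
    · rw [PowerSeries.constantCoeff_aeval hy, hP.1, map_zero]
    · rw [PowerSeries.derivative_aeval]
      exact Finset.dvd_sum fun i _ => (ih (hP.2 i)).mul_right _

/-! ### Construction of the extremal polynomials. -/

open Polynomial in
/-- For `k ≥ 1`, the polynomial `∑_{0 < j < k} catalan (j - 1) t ^ j`, the truncated compositional
inverse of `x (1 - x)`. -/
noncomputable def truncInverse (k : ℕ) : ℝ[X] :=
  ∑ j ∈ Finset.range (k - 1), C (catalan j : ℝ) * X ^ (j + 1)

section Upper

open Polynomial

theorem catalan_map_relation {A : Type*} [CommRing A] :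
    (PowerSeries.X * PowerSeries.mk (fun j => (catalan j : A))) *
      (1 - PowerSeries.X * PowerSeries.mk (fun j => (catalan j : A))) = PowerSeries.X := by
  have h := congrArg (PowerSeries.map (Nat.castRingHom A))
    PowerSeries.catalanSeries_sq_mul_X_add_one
  have hc : PowerSeries.map (Nat.castRingHom A) PowerSeries.catalanSeries =
      PowerSeries.mk (fun j => (catalan j : A)) := by
    ext j
    simp [PowerSeries.catalanSeries_coeff]
  simp only [map_add, map_mul, map_pow, map_one, PowerSeries.map_X, hc] at h
  linear_combination -PowerSeries.X * h

theorem coeff_truncInverse {k m : ℕ} (hm : m < k) : (truncInverse k).coeff m =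
    PowerSeries.coeff m (PowerSeries.X * PowerSeries.mk (fun j => (catalan j : ℝ))) := by
  rcases m with _ | m
  · simp [truncInverse, finsetSum_coeff, coeff_X_pow]
  · rw [PowerSeries.coeff_succ_X_mul]
    simp only [truncInverse, finsetSum_coeff, coeff_C_mul, coeff_X_pow, PowerSeries.coeff_mk]
    rw [Finset.sum_eq_single m]
    · simp
    · intro b _ hb
      simp [hb.symm]
    · intro h
      simp at h
      omega

theorem X_pow_dvd_truncInverse_mul (k : ℕ) :
    (X : ℝ[X]) ^ k ∣ truncInverse k * (1 - truncInverse k) - X := by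
  set f : PowerSeries ℝ := PowerSeries.X * PowerSeries.mk (fun j => (catalan j : ℝ)) with hf
  have h1 : PowerSeries.X ^ k ∣ (truncInverse k : PowerSeries ℝ) - f := by
    rw [PowerSeries.X_pow_dvd_iff]
    intro m hm
    rw [map_sub, Polynomial.coeff_coe, coeff_truncInverse hm, sub_self]
  have h2 : PowerSeries.X ^ k ∣
      ((truncInverse k * (1 - truncInverse k) - X : ℝ[X]) : PowerSeries ℝ) := by
    -- `f (1 - f) = X`, so the difference factors through `truncInverse k - f`.
    have : ((truncInverse k * (1 - truncInverse k) - X : ℝ[X]) : PowerSeries ℝ) =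
        ((truncInverse k : PowerSeries ℝ) - f) * (1 - truncInverse k - f) := by
      have := catalan_map_relation (A := ℝ)
      rw [← hf] at this
      push_cast
      linear_combination this
    rw [this]
    exact h1.mul_right _
  rw [PowerSeries.X_pow_dvd_iff] at h2
  rw [Polynomial.X_pow_dvd_iff]
  intro m hm
  rw [← Polynomial.coeff_coe]
  exact h2 m hm

/-- Both `z` and `x` solve `y (1 - y) = x (1 - x)` modulo `x ^ k`; the cofactor `1 - z - x` has
constant term `1`, so it cancels. -/
theorem X_pow_dvd_truncInverse_comp (k : ℕ) :
    (X : ℝ[X]) ^ k ∣ (truncInverse k).comp (X * (1 - X)) - X := by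
  set z := (truncInverse k).comp (X * (1 - X)) with hz
  have h1 : (X : ℝ[X]) ^ k ∣ (1 - z - X) * (z - X) := by
    have h := map_dvd (compRingHom (X * (1 - X) : ℝ[X])) (X_pow_dvd_truncInverse_mul k)
    simp only [coe_compRingHom, pow_comp, X_comp, sub_comp, mul_comp, one_comp, ← hz] at h
    have h' : (X : ℝ[X]) ^ k ∣ z * (1 - z) - X * (1 - X) :=
      (pow_dvd_pow_of_dvd (Dvd.intro _ rfl) k).trans h
    convert h' using 1
    ring
  refine IsCoprime.dvd_of_dvd_mul_left (IsCoprime.pow_left ?_) h1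
  rw [Polynomial.irreducible_X.coprime_iff_not_dvd, X_dvd_iff, coeff_zero_eq_eval_zero]
  simp [hz, truncInverse, eval_finsetSum]

/-- The homogeneous pieces of `1 - x - c (x (1 - x))`, with `c` the inverse series of
`x (1 - x)`. -/
noncomputable def cubeFactor : ℕ → ℝ[X]
  | 0 => 1 - X
  | j + 1 => -(C (catalan j : ℝ) * (X * (1 - X)) ^ (j + 1))

theorem sum_cubeFactor {k : ℕ} (hk : 1 ≤ k) : ∑ j ∈ Finset.range k, cubeFactor j =
    1 - X - (truncInverse k).comp (X * (1 - X)) := by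
  obtain ⟨k, rfl⟩ := Nat.exists_eq_add_of_le' hk
  rw [Finset.sum_range_succ']
  simp only [cubeFactor, truncInverse, Finset.sum_neg_distrib, Nat.add_sub_cancel,
    ← coe_compRingHom_apply, map_sum]
  simp
  ring

/-- The previous divisibility under the symmetry `x ↦ 1 - x`, which fixes `x (1 - x)`. -/
theorem pow_dvd_sum_cubeFactor {k : ℕ} (hk : 1 ≤ k) :
    (1 - X : ℝ[X]) ^ k ∣ ∑ j ∈ Finset.range k, cubeFactor j := by
  have h := map_dvd (compRingHom (1 - X : ℝ[X])) (X_pow_dvd_truncInverse_comp k)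
  rw [sum_cubeFactor hk, ← dvd_neg]
  simp only [coe_compRingHom, pow_comp, X_comp, sub_comp, comp_assoc, mul_comp, one_comp] at h
  convert h using 1
  rw [show (1 - X : ℝ[X]) * (1 - (1 - X)) = X * (1 - X) by ring]
  ring

theorem natDegree_cubeFactor_le (j : ℕ) : (cubeFactor j).natDegree ≤ if j = 0 then 1 else 2 * j := by
  have h1 : (1 - X : ℝ[X]).natDegree ≤ 1 := by compute_degree
  rcases j with _ | j
  · simpa [cubeFactor] using h1
  · rw [cubeFactor, natDegree_neg, if_neg (by omega)]
    refine (natDegree_C_mul_le _ _).trans ((natDegree_pow_le).trans ?_)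
    have : (X * (1 - X) : ℝ[X]).natDegree ≤ 2 := by compute_degree
    nlinarith

variable {n : ℕ}

/-- The truncation of `∏ i, (1 - xᵢ - c (xᵢ (1 - xᵢ)))` to terms of degree less than `k` in the
`xᵢ (1 - xᵢ)`. -/
noncomputable def cubePoly (k n : ℕ) : MvPolynomial (Fin n) ℝ :=
  ∑ e ∈ Fintype.piFinset (fun _ : Fin n => Finset.range k) with ∑ i, e i < k,
    ∏ i, aeval (MvPolynomial.X i) (cubeFactor (e i))

theorem totalDegree_aeval_X_le (p : ℝ[X]) (i : Fin n) :
    (aeval (MvPolynomial.X i : MvPolynomial (Fin n) ℝ) p).totalDegree ≤ p.natDegree := by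
  rw [aeval_eq_sum_range]
  refine MvPolynomial.totalDegree_finsetSum_le fun j hj => ?_
  refine (MvPolynomial.totalDegree_smul_le _ _).trans ?_
  rw [MvPolynomial.totalDegree_X_pow]
  exact Finset.mem_range_succ_iff.1 hj

theorem totalDegree_cubePoly_le {k : ℕ} (hk : 2 ≤ k) :
    (cubePoly k n).totalDegree ≤ n + 2 * k - 3 := by
  refine MvPolynomial.totalDegree_finsetSum_le fun e he => ?_
  rw [Finset.mem_filter] at he
  refine (MvPolynomial.totalDegree_finsetProd _ _).trans ?_
  refine (Finset.sum_le_sum fun i _ =>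
    (totalDegree_aeval_X_le _ i).trans (natDegree_cubeFactor_le (e i))).trans ?_
  have hle : ∀ i, (if e i = 0 then 1 else 2 * e i) ≤ 2 * e i + 1 := fun i => by split_ifs <;> omega
  have hsum : ∑ i, (2 * e i + 1) = 2 * ∑ i, e i + n := by
    simp [Finset.sum_add_distrib, Finset.mul_sum]
  -- An index with `e i ≠ 0` costs `2 * e i` rather than `2 * e i + 1`; this saves the last unit of
  -- degree.
  by_cases h0 : ∀ i, e i = 0
  · simp [h0]
    omega
  · push Not at h0
    obtain ⟨i, hi⟩ := h0
    have : ∑ i, (if e i = 0 then 1 else 2 * e i) < ∑ i, (2 * e i + 1) :=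
      Finset.sum_lt_sum (fun i _ => hle i) ⟨i, Finset.mem_univ i, by rw [if_neg hi]; omega⟩
    omega

theorem eval_aeval_X (a : Fin n → ℝ) (i : Fin n) (p : ℝ[X]) :
    MvPolynomial.eval a (aeval (MvPolynomial.X i) p) = p.eval (a i) := by
  rw [← MvPolynomial.coe_aeval_eq_eval, RingHom.coe_coe, ← aeval_algHom_apply,
    MvPolynomial.aeval_X, coe_aeval_eq_eval]

theorem eval_zero_cubePoly {k : ℕ} (hk : 1 ≤ k) : MvPolynomial.eval 0 (cubePoly k n) = 1 := by
  rw [cubePoly, map_sum, Finset.sum_eq_single 0]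
  · simp [map_prod, cubeFactor]
  · intro e _ he
    obtain ⟨i, hi⟩ := Function.ne_iff.1 he
    rw [map_prod]
    refine Finset.prod_eq_zero (Finset.mem_univ i) ?_
    rw [eval_aeval_X]
    obtain ⟨j, hj⟩ := Nat.exists_eq_succ_of_ne_zero hi
    simp [hj, cubeFactor]
  · intro h
    have hk' : 0 < k := hk
    simp [hk'] at h

theorem HasZeroOfMultAtLeast.aeval_X_cubeFactor {a : Fin n → ℝ} (ha : ∀ i, a i = 0 ∨ a i = 1)
    (i : Fin n) (j : ℕ) :
    HasZeroOfMultAtLeast (aeval (MvPolynomial.X i) (cubeFactor j)) a j := by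
  rcases j with _ | j
  · exact zero_order
  · refine (pow (P := aeval (MvPolynomial.X i) (X * (1 - X) : ℝ[X])) ?_ (j + 1)).of_dvd ?_
    · rw [one_iff, eval_aeval_X]
      rcases ha i with h | h <;> simp [h]
    · rw [← map_pow]
      exact map_dvd _ (dvd_neg.2 (Dvd.intro_left _ rfl))

theorem vanishesOnPuncturedCube_cubePoly {k : ℕ} (hk : 1 ≤ k) :
    VanishesOnPuncturedCube (cubePoly k n) k := by
  intro a ha ha0
  have hfull : HasZeroOfMultAtLeast
      (∑ e ∈ Fintype.piFinset (fun _ : Fin n => Finset.range k),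
        ∏ i, aeval (MvPolynomial.X i : MvPolynomial (Fin n) ℝ) (cubeFactor (e i))) a k := by
    rw [← Finset.prod_univ_sum (fun _ : Fin n => Finset.range k)
      (fun i j => aeval (MvPolynomial.X i : MvPolynomial (Fin n) ℝ) (cubeFactor j))]
    obtain ⟨i, hi⟩ := Function.ne_iff.1 ha0
    refine (HasZeroOfMultAtLeast.pow
      (P := aeval (MvPolynomial.X i : MvPolynomial (Fin n) ℝ) (1 - X : ℝ[X])) ?_ k).of_dvd ?_
    · rw [HasZeroOfMultAtLeast.one_iff, eval_aeval_X]
      simp [(ha i).resolve_left hi]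
    · refine Dvd.dvd.trans ?_ (Finset.dvd_prod_of_mem _ (Finset.mem_univ i))
      rw [← map_pow, ← map_sum]
      exact map_dvd _ (pow_dvd_sum_cubeFactor hk)
  rw [← Finset.sum_filter_add_sum_filter_not _ (fun e => ∑ i, e i < k)] at hfull
  have hrest : HasZeroOfMultAtLeast
      (∑ e ∈ Fintype.piFinset (fun _ : Fin n => Finset.range k) with ¬ ∑ i, e i < k,
        ∏ i, aeval (MvPolynomial.X i : MvPolynomial (Fin n) ℝ) (cubeFactor (e i))) a k := by
    refine HasZeroOfMultAtLeast.sum fun e he => ?_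
    rw [Finset.mem_filter] at he
    exact (HasZeroOfMultAtLeast.prod fun i _ =>
      HasZeroOfMultAtLeast.aeval_X_cubeFactor ha i (e i)).mono (not_lt.1 he.2)
  simpa [cubePoly] using hfull.add hrest.neg

/-- Polynomials of low degree with zeroes of multiplicity at least `k` on the punctured cube and
multiplicity exactly `l` at the origin. -/
theorem exists_vanishing_with_exact_mult {k l : ℕ} (hl : l + 2 ≤ k) (i : Fin n) :
    ∃ P : MvPolynomial (Fin n) ℝ, P.totalDegree ≤ n + 2 * k - 3 ∧
      VanishesOnPuncturedCube P k ∧ HasZeroOfMultExactly P 0 l := by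
  induction l generalizing k with
  | zero =>
    refine ⟨cubePoly k n, totalDegree_cubePoly_le (by omega),
      vanishesOnPuncturedCube_cubePoly (by omega), HasZeroOfMultAtLeast.zero_order, ?_⟩
    rw [zero_add, HasZeroOfMultAtLeast.one_iff, eval_zero_cubePoly (by omega)]
    exact one_ne_zero
  | succ l ih =>
    obtain ⟨k, rfl⟩ : ∃ k', k = k' + 1 := ⟨k - 1, by omega⟩
    obtain ⟨P, hdeg, hvan, hl0, hl1⟩ := ih (k := k) (by omega)
    have hone : ∀ a : Fin n → ℝ, (∀ i, a i = 0 ∨ a i = 1) → HasZeroOfMultAtLeast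
        (MvPolynomial.X i * (1 - MvPolynomial.X i) : MvPolynomial (Fin n) ℝ) a 1 := by
      intro a ha
      rw [HasZeroOfMultAtLeast.one_iff]
      rcases ha i with h | h <;> simp [h]
    refine ⟨P * (MvPolynomial.X i * (1 - MvPolynomial.X i)), ?_, ?_, ?_, ?_⟩
    · refine (MvPolynomial.totalDegree_mul _ _).trans ?_
      have h1 : (1 - MvPolynomial.X i : MvPolynomial (Fin n) ℝ).totalDegree ≤ 1 :=
        (MvPolynomial.totalDegree_sub _ _).trans (by simp)
      have h2 := MvPolynomial.totalDegree_mul (MvPolynomial.X i : MvPolynomial (Fin n) ℝ)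
        (1 - MvPolynomial.X i)
      rw [MvPolynomial.totalDegree_X] at h2
      omega
    · exact fun a ha ha0 => (hvan a ha ha0).mul (hone a ha)
    · exact hl0.mul (hone 0 fun _ => Or.inl rfl)
    · intro h
      apply hl1
      -- `1 - xᵢ` is nonzero at the origin and cancels; multiplication by `xᵢ` only shifts
      -- coefficients.
      have hX : HasZeroOfMultAtLeast (MvPolynomial.X i * P) 0 (l + 1 + 1) := by
        refine HasZeroOfMultAtLeast.of_mul_right (Q := 1 - MvPolynomial.X i) ?_ (by simp)
        convert h using 1
        ring
      rw [HasZeroOfMultAtLeast.at_zero_iff] at hX ⊢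
      intro d hd
      have := hX (Finsupp.single i 1 + d) (by simp [Finsupp.degree_single]; omega)
      rwa [MvPolynomial.coeff_X_mul] at this

end Upper

/-! ### Alternating sums over coordinate flips. -/

open Polynomial in
/-- Up to a factor `1 - 2 x`, the difference `x ^ d - (1 - x) ^ d` is a polynomial of degree at
most `(d - 1) / 2` in `x (1 - x)`. -/
theorem exists_pow_sub_one_sub_pow_eq {A R : Type*} [CommRing A] [CommRing R] (φ : A[X] →+* R)
    (u : A) (x : R) (hx : x * (1 - x) = φ (C u * X)) (d : ℕ) :
    ∃ g : A[X], (∀ j, d < 1 + 2 * j → g.coeff j = 0) ∧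
      x ^ d - (1 - x) ^ d = (1 - 2 * x) * φ g := by
  induction d using Nat.twoStepInduction with
  | zero => exact ⟨0, by simp, by simp⟩
  | one =>
    refine ⟨-1, fun j hj => ?_, by simp; ring⟩
    rw [coeff_neg, coeff_one, if_neg (by omega), neg_zero]
  | more d ih0 ih1 =>
    obtain ⟨g0, h0, e0⟩ := ih0
    obtain ⟨g1, h1, e1⟩ := ih1
    -- `x` and `1 - x` are the roots of `t ^ 2 - t + x (1 - x)`, which gives the two-term
    -- recurrence.
    refine ⟨g1 - C u * X * g0, fun j hj => ?_, ?_⟩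
    · obtain ⟨j, rfl⟩ : ∃ j', j = j' + 1 := ⟨j - 1, by omega⟩
      rw [mul_assoc, coeff_sub, coeff_C_mul, coeff_X_mul, h1 _ (by omega), h0 _ (by omega)]
      simp
    · rw [map_sub, map_mul φ (C u * X), ← hx, mul_sub, ← e1]
      linear_combination -x * (1 - x) * e0

open Polynomial in
-- Degrees add. The bound `(d - 1) / 2` is phrased through coefficients so that `d = 0` forces `g =
-- 0`.
theorem coeff_prod_eq_zero_of_weight {ι A : Type*} [CommRing A] (s : Finset ι) (g : ι → A[X])
    (d : ι → ℕ) (hg : ∀ i ∈ s, ∀ j, d i < 1 + 2 * j → (g i).coeff j = 0) (j : ℕ)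
    (hj : ∑ i ∈ s, d i < s.card + 2 * j) : (∏ i ∈ s, g i).coeff j = 0 := by
  classical
  induction s using Finset.induction_on generalizing j with
  | empty =>
    rw [Finset.prod_empty, coeff_one, if_neg]
    rintro rfl
    simp at hj
  | insert i s his ih =>
    rw [Finset.prod_insert his, coeff_mul]
    rw [Finset.sum_insert his, Finset.card_insert_of_notMem his] at hj
    refine Finset.sum_eq_zero fun ab hab => ?_
    rw [Finset.HasAntidiagonal.mem_antidiagonal] at hab
    by_cases h : d i < 1 + 2 * ab.1
    · rw [hg i (Finset.mem_insert_self i s) _ h, zero_mul]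
    · rw [ih (fun j hj => hg j (Finset.mem_insert_of_mem hj)) ab.2 (by omega), mul_zero]

section Lower

variable {n : ℕ} {A : Type*} [CommRing A] [Algebra ℝ A]

/-- The point with coordinates `1 - xᵢ` where `S i` holds and `xᵢ` elsewhere. -/
def cubeFlip {R : Type*} [CommRing R] (x : Fin n → R) (S : Fin n → Bool) (i : Fin n) : R :=
  if S i then 1 - x i else x i

/-- The sign `(-1) ^ |S|`. -/
def flipSign (R : Type*) [CommRing R] (S : Fin n → Bool) : R := ∏ i, if S i then -1 else 1

theorem sum_flipSign_mul_prod {R : Type*} [CommRing R] (x : Fin n → R) (d : Fin n → ℕ) :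
    ∑ S : Fin n → Bool, flipSign R S * ∏ i, cubeFlip x S i ^ d i =
      ∏ i, (x i ^ d i - (1 - x i) ^ d i) := by
  have h := Finset.prod_univ_sum (fun _ : Fin n => (Finset.univ : Finset Bool))
    (fun i b => (if b then (-1 : R) else 1) * (if b then 1 - x i else x i) ^ d i)
  rw [Fintype.piFinset_univ] at h
  calc _ = ∑ S : Fin n → Bool, ∏ i, ((if S i then (-1 : R) else 1) *
          (if S i then 1 - x i else x i) ^ d i) :=
        Finset.sum_congr rfl fun S _ => Finset.prod_mul_distrib.symm
    _ = _ := h.symm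
    _ = _ := Finset.prod_congr rfl fun i _ => by simp; ring

open Polynomial in
/-- The alternating sum of `P` over the `2 ^ n` formal points above `(uᵢ s)ᵢ` under
`x ↦ x (1 - x)` is, up to the factor `∏ (1 - 2 xᵢ)`, a polynomial in `s` of degree at most
`(deg P - n) / 2`. -/
theorem exists_sum_flip_aeval_eq (u : Fin n → A) (x : Fin n → PowerSeries A)
    (hx : ∀ i, x i * (1 - x i) = ((C (u i) * X : A[X]) : PowerSeries A))
    (P : MvPolynomial (Fin n) ℝ) :
    ∃ p : A[X], (∀ j, P.totalDegree < n + 2 * j → p.coeff j = 0) ∧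
      ∑ S : Fin n → Bool, flipSign (PowerSeries A) S * MvPolynomial.aeval (cubeFlip x S) P =
        (∏ i, (1 - 2 * x i)) * (p : PowerSeries A) := by
  choose g hg hge using fun i =>
    exists_pow_sub_one_sub_pow_eq (Polynomial.coeToPowerSeries.ringHom (R := A)) (u i) (x i) (hx i)
  refine ⟨∑ d ∈ P.support, C (algebraMap ℝ A (P.coeff d)) * ∏ i, g i (d i), fun j hj => ?_, ?_⟩
  · rw [finsetSum_coeff]
    refine Finset.sum_eq_zero fun d hd => ?_
    rw [coeff_C_mul, coeff_prod_eq_zero_of_weight _ _ (fun i => d i) (fun i _ => hg i (d i)) j,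
      mul_zero]
    have := MvPolynomial.le_totalDegree hd
    rw [Finsupp.sum_fintype _ _ (fun _ => rfl)] at this
    simpa using this.trans_lt hj
  · have key : ∀ d : Fin n →₀ ℕ, ∑ S : Fin n → Bool, flipSign (PowerSeries A) S *
        ∏ i, cubeFlip x S i ^ d i = (∏ i, (1 - 2 * x i)) * ((∏ i, g i (d i) : A[X]) : PowerSeries A) := by
      intro d
      rw [sum_flipSign_mul_prod, ← coeToPowerSeries.ringHom_apply, map_prod,
        ← Finset.prod_mul_distrib]
      exact Finset.prod_congr rfl fun i _ => hge i (d i)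
    simp only [MvPolynomial.aeval_def, MvPolynomial.eval₂_eq', Finset.mul_sum]
    rw [Finset.sum_comm, ← coeToPowerSeries.ringHom_apply, map_sum, Finset.mul_sum]
    refine Finset.sum_congr rfl fun d _ => ?_
    rw [map_mul, mul_left_comm, coeToPowerSeries.ringHom_apply, coeToPowerSeries.ringHom_apply,
      ← key, coe_C, IsScalarTower.algebraMap_apply ℝ A (PowerSeries A), Finset.mul_sum]
    exact Finset.sum_congr rfl fun S _ => mul_left_comm _ _ _

end Lower

/-! ### Generic formal arcs and the lower bound. -/

section Lower

variable {n : ℕ} {A : Type*} [CommRing A]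

/-- The Catalan generating series evaluated at `u s`. -/
noncomputable def catalanScaled (u : A) : PowerSeries A :=
  PowerSeries.rescale u (PowerSeries.mk fun j => (catalan j : A))

/-- The formal root of `x (1 - x) = u s` with vanishing constant term. -/
noncomputable def formalRoot (u : A) : PowerSeries A :=
  PowerSeries.C u * PowerSeries.X * catalanScaled u

theorem coeff_catalanScaled (u : A) (j : ℕ) :
    PowerSeries.coeff j (catalanScaled u) = u ^ j * catalan j := by
  simp [catalanScaled, PowerSeries.coeff_rescale]

theorem constantCoeff_catalanScaled (u : A) :
    PowerSeries.constantCoeff (catalanScaled u) = 1 := by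
  simpa using coeff_catalanScaled u 0

theorem constantCoeff_formalRoot (u : A) : PowerSeries.constantCoeff (formalRoot u) = 0 := by
  simp [formalRoot]

theorem formalRoot_mul (u : A) : formalRoot u * (1 - formalRoot u) =
    PowerSeries.C u * PowerSeries.X := by
  have h := congrArg (PowerSeries.rescale u) (catalan_map_relation (A := A))
  simp only [map_mul, map_sub, map_one, PowerSeries.rescale_X] at h
  exact h

/-- Each root is `uᵢ s` times a series with constant term `1`, so a monomial in the roots has
leading term `u ^ d * s ^ |d|`. -/
theorem coeff_prod_formalRoot_pow (u : Fin n → A) (d : Fin n →₀ ℕ) {m : ℕ} (hm : m ≤ d.degree) :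
    PowerSeries.coeff m (∏ i, formalRoot (u i) ^ d i) =
      if d.degree = m then ∏ i, u i ^ d i else 0 := by
  have hprod : ∏ i, formalRoot (u i) ^ d i =
      PowerSeries.C (∏ i, u i ^ d i) * (PowerSeries.X ^ d.degree *
        ∏ i, catalanScaled (u i) ^ d i) := by
    simp only [formalRoot, mul_pow, Finset.prod_mul_distrib, map_prod, map_pow, mul_assoc]
    rw [Finset.prod_pow_eq_pow_sum, ← Finsupp.degree_eq_sum]
  rw [hprod, PowerSeries.coeff_C_mul, PowerSeries.coeff_X_pow_mul']
  by_cases h : d.degree = m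
  · rw [if_pos h.le, if_pos h, h, Nat.sub_self, PowerSeries.coeff_zero_eq_constantCoeff_apply,
      map_prod]
    simp [constantCoeff_catalanScaled]
  · rw [if_neg h, if_neg (by omega), mul_zero]

theorem VanishesOnPuncturedCube.mul_left {P : MvPolynomial (Fin n) ℝ} {k : ℕ}
    (h : VanishesOnPuncturedCube P k) (Q : MvPolynomial (Fin n) ℝ) :
    VanishesOnPuncturedCube (Q * P) k :=
  fun a ha ha0 => (h a ha ha0).mul_left Q

variable [Algebra ℝ A]

open Polynomial in
/-- If `P` vanishes to order `k` on the punctured cube, then its restriction to the formal arc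
`formalRoot` through the origin agrees to order `k`, up to the factor `∏ (1 - 2 xᵢ)`, with a
polynomial of degree at most `(deg P - n) / 2`. -/
theorem VanishesOnPuncturedCube.exists_dvd_sub {P : MvPolynomial (Fin n) ℝ} {k : ℕ}
    (h : VanishesOnPuncturedCube P k) (u : Fin n → A) :
    ∃ p : A[X], (∀ j, P.totalDegree < n + 2 * j → p.coeff j = 0) ∧
      PowerSeries.X ^ k ∣ MvPolynomial.aeval (fun i => formalRoot (u i)) P -
        (∏ i, (1 - 2 * formalRoot (u i))) * (p : PowerSeries A) := by
  obtain ⟨p, hp, hpe⟩ := exists_sum_flip_aeval_eq u (fun i => formalRoot (u i))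
    (fun i => by rw [formalRoot_mul, coe_mul, coe_C, coe_X]) P
  refine ⟨p, hp, ?_⟩
  rw [← hpe, ← Finset.add_sum_erase _ _ (Finset.mem_univ fun _ => false)]
  have h0 : flipSign (PowerSeries A) (fun _ : Fin n => false) *
      MvPolynomial.aeval (cubeFlip (fun i => formalRoot (u i)) fun _ => false) P =
        MvPolynomial.aeval (fun i => formalRoot (u i)) P := by
    have : cubeFlip (fun i => formalRoot (u i)) (fun _ => false) = fun i => formalRoot (u i) := by
      funext i
      simp [cubeFlip]
    rw [this]
    simp [flipSign]
  rw [h0, sub_add_cancel_left, dvd_neg]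
  refine Finset.dvd_sum fun S hS => Dvd.dvd.mul_left ?_ _
  have hS' : S ≠ fun _ => false := Finset.ne_of_mem_erase hS
  refine (h (fun i => if S i then 1 else 0) (fun i => ?_) ?_).X_pow_dvd_aeval _ fun i => ?_
  · cases S i <;> simp
  · obtain ⟨i, hi⟩ := Function.ne_iff.1 hS'
    intro h
    have := congrFun h i
    simp_all
  · cases hi : S i <;> simp [cubeFlip, hi, constantCoeff_formalRoot]

open Polynomial in
/-- A polynomial of degree at most `n + 2 k - 4` vanishing to order `k` on the punctured cube
vanishes to order `k` along the formal arcs `formalRoot` with distinct nonzero directions. -/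
theorem VanishesOnPuncturedCube.X_pow_dvd_aeval_formalRoot [IsDomain A]
    {P : MvPolynomial (Fin n) ℝ} {k : ℕ}
    (h : VanishesOnPuncturedCube P k) (hk : 2 ≤ k) (hn : k ≤ n + 1)
    (hdeg : P.totalDegree + 4 ≤ n + 2 * k) (u : Fin n → A) (hu : Function.Injective u)
    (hu0 : ∀ i, u i ≠ 0) :
    PowerSeries.X ^ k ∣ MvPolynomial.aeval (fun i => formalRoot (u i)) P := by
  obtain ⟨k, rfl⟩ : ∃ m, k = m + 2 := ⟨k - 2, by omega⟩
  obtain ⟨p, hp, hpd⟩ := h.exists_dvd_sub u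
  set E : PowerSeries A := ∏ i, (1 - 2 * formalRoot (u i)) with hE
  have hEu : IsUnit E := by
    rw [PowerSeries.isUnit_iff_constantCoeff, hE, map_prod]
    simp [constantCoeff_formalRoot]
  have hroot : ∀ i, PowerSeries.coeff k (catalanScaled (u i) * (p : PowerSeries A)) = 0 := by
    intro i
    -- Parity: multiplying by `xᵢ` raises the degree by one, yet `q` still has no coefficient at `s
    -- ^ (k + 1)`.
    obtain ⟨q, hq, hqd⟩ := (h.mul_left (MvPolynomial.X i)).exists_dvd_sub u
    rw [← hE, map_mul, MvPolynomial.aeval_X] at hqd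
    have hd : PowerSeries.X ^ (k + 2) ∣ formalRoot (u i) * (p : PowerSeries A) - (q : PowerSeries A) := by
      rw [← hEu.dvd_mul_left]
      have := dvd_sub hqd (hpd.mul_left (formalRoot (u i)))
      convert this using 1
      ring
    have hc := PowerSeries.X_pow_dvd_iff.1 hd (k + 1) (by omega)
    have hqk : q.coeff (k + 1) = 0 := by
      apply hq
      have := MvPolynomial.totalDegree_mul (MvPolynomial.X i) P
      rw [MvPolynomial.totalDegree_X] at this
      omega
    rw [map_sub, Polynomial.coeff_coe, hqk, sub_zero, formalRoot, mul_assoc, mul_assoc,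
      PowerSeries.coeff_C_mul, PowerSeries.coeff_succ_X_mul] at hc
    exact (mul_eq_zero.1 hc).resolve_left (hu0 i)
  -- As a polynomial in a new variable this has degree at most `k` and vanishes at `n ≥ k + 1`
  -- distinct `uᵢ`.
  have hH : ∑ j ∈ Finset.range (k + 1), C ((catalan j : A) * p.coeff (k - j)) * X ^ j = 0 := by
    refine eq_zero_of_natDegree_lt_card_of_eval_eq_zero _ hu (fun i => ?_) ?_
    · have := hroot i
      rw [PowerSeries.coeff_mul, Finset.Nat.sum_antidiagonal_eq_sum_range_succ_mk] at this
      rw [eval_finsetSum, ← this]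
      refine Finset.sum_congr rfl fun j _ => ?_
      simp only [coeff_catalanScaled, Polynomial.coeff_coe, eval_mul, eval_C, eval_pow, eval_X]
      ring
    · rw [Fintype.card_fin]
      refine lt_of_le_of_lt (b := k) (natDegree_sum_le_of_forall_le _ _ fun j hj => ?_) (by omega)
      exact (natDegree_C_mul_X_pow_le _ _).trans (Finset.mem_range_succ_iff.1 hj)
  have hp0 : p = 0 := by
    ext j
    rw [coeff_zero]
    by_cases hj : j ≤ k
    · have hc := congrArg (fun f => coeff f (k - j)) hH
      simp only [finsetSum_coeff, coeff_C_mul_X_pow, coeff_zero] at hc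
      rw [Finset.sum_ite_eq, if_pos (by simp), Nat.sub_sub_self hj] at hc
      refine (mul_eq_zero.1 hc).resolve_left ?_
      have hcat : catalan (k - j) ≠ 0 := by
        intro h0
        have h1 := succ_mul_catalan_eq_centralBinom (k - j)
        rw [h0, mul_zero] at h1
        exact (Nat.centralBinom_ne_zero _) h1.symm
      have := (algebraMap ℝ A).injective.ne (Nat.cast_ne_zero.2 hcat)
      simpa using this
    · exact hp j (by omega)
  simpa [hp0] using hpd

/-- The order of vanishing at the origin can be read off along the generic formal arc. -/
theorem HasZeroOfMultAtLeast.of_X_pow_dvd_aeval_formalRoot {P : MvPolynomial (Fin n) ℝ} {k : ℕ}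
    (h : PowerSeries.X ^ k ∣ MvPolynomial.aeval
      (fun i => formalRoot (MvPolynomial.X i : MvPolynomial (Fin n) ℝ)) P) :
    HasZeroOfMultAtLeast P 0 k := by
  rw [at_zero_iff]
  suffices H : ∀ m, m < k → ∀ d : Fin n →₀ ℕ, d.degree = m → P.coeff d = 0 from
    fun d hd => H _ hd d rfl
  intro m
  induction m using Nat.strong_induction_on with
  | _ m ih =>
    intro hm d hd
    have hc := PowerSeries.X_pow_dvd_iff.1 h m hm
    rw [MvPolynomial.aeval_def, MvPolynomial.eval₂_eq', map_sum] at hc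
    -- With lower degrees already gone, the coefficient of `s ^ m` is the degree-`m` homogeneous
    -- part of `P` in the variables `uᵢ`.
    have hc2 : ∑ e ∈ P.support, (if e.degree = m then MvPolynomial.monomial e (P.coeff e) else 0) =
        0 := by
      refine Eq.trans (Finset.sum_congr rfl fun e he => ?_) hc
      have hme : m ≤ e.degree := by
        by_contra hlt
        exact MvPolynomial.mem_support_iff.1 he (ih _ (not_le.1 hlt) ((not_le.1 hlt).trans hm) e rfl)
      rw [IsScalarTower.algebraMap_apply ℝ (MvPolynomial (Fin n) ℝ) (PowerSeries _),
        PowerSeries.algebraMap_eq, PowerSeries.coeff_C_mul, coeff_prod_formalRoot_pow _ _ hme,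
        MvPolynomial.algebraMap_eq]
      split_ifs
      · rw [MvPolynomial.monomial_eq, Finsupp.prod_fintype _ _ (fun _ => pow_zero _)]
      · rw [mul_zero]
    have hcd := congrArg (MvPolynomial.coeff d) hc2
    rw [MvPolynomial.coeff_sum, Finset.sum_eq_single d] at hcd
    · simpa [hd] using hcd
    · intro e _ hed
      split_ifs
      · rw [MvPolynomial.coeff_monomial, if_neg hed]
      · exact MvPolynomial.coeff_zero d
    · intro hds
      rw [MvPolynomial.notMem_support_iff.1 hds]
      simp

theorem VanishesOnPuncturedCube.le_totalDegree {P : MvPolynomial (Fin n) ℝ} {k : ℕ}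
    (h : VanishesOnPuncturedCube P k) (hk : 2 ≤ k) (hn : k ≤ n + 1)
    (h0 : ¬ HasZeroOfMultAtLeast P 0 (k - 1)) : n + 2 * k - 3 ≤ P.totalDegree := by
  by_contra hlt
  exact h0 ((HasZeroOfMultAtLeast.of_X_pow_dvd_aeval_formalRoot
    (h.X_pow_dvd_aeval_formalRoot hk hn (by omega) _ (MvPolynomial.X_injective)
      MvPolynomial.X_ne_zero)).mono (Nat.sub_le k 1))

end Lower

theorem theorem2 (k n : ℕ) (hk : 2 ≤ k) (hn : 2 * k - 3 ≤ n) :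
    (∀ P : MvPolynomial (Fin n) ℝ, VanishesOnPuncturedCube P k →
      ¬ HasZeroOfMultAtLeast P 0 (k - 1) → n + 2 * k - 3 ≤ P.totalDegree) ∧
    (∀ l : ℕ, l ≤ k - 2 → ∃ P : MvPolynomial (Fin n) ℝ, P.totalDegree = n + 2 * k - 3 ∧
      VanishesOnPuncturedCube P k ∧ HasZeroOfMultExactly P 0 l) := by
  refine ⟨fun P hP h0 => hP.le_totalDegree hk (by omega) h0, fun l hl => ?_⟩
  obtain ⟨P, hdeg, hvan, hex⟩ :=
    exists_vanishing_with_exact_mult (k := k) (l := l) (by omega) (⟨0, by omega⟩ : Fin n)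
  -- Since `l + 1 ≤ k - 1`, the lower bound applies to this `P` and makes its degree exact.
  refine ⟨P, le_antisymm hdeg (hvan.le_totalDegree hk (by omega) fun h => ?_), hvan, hex⟩
  exact hex.2 (h.mono (by omega))
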